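/- **Setting.** Let $G=(V,E)$ be a finite directed graph with $n=|V|$ users, and let $r\ge 1$ be a number of features with $nr\ge 2$. Let $p^i_e\in[0,1]$ for $e\in E$, $1\le i\le r$, let $w^1,\dots,w^r\ge 0$ with $\sum_i w^i=1$, and put $\bar w=\max_i w^i$. The layer $G^i$ is a copy of $G$ in which each edge $e$ is live independently with probability $p^i_e$, independently over layers; the resulting random graph $g^i$ of live edges is a realization of $G^i$. Write $v^i$ for the copy of the user $v$ in layer $i$. Let $S_r\subseteq V$ be the set of rumor seed users, $n_r=|S_r|$, and let $S_r^i\subseteq S_r$ be those whose copy in layer $i$ accepts the rumor. For $S\subseteq V\setminus S_r$, in each layer $i$ the rumor (from $S^i_r$) and the positive cascade (from $S$) spread in synchronous rounds along live edges, each node keeps the first cascade that reaches it, and ties go to the rumor; $r(v^i)\in\{0,1\}$ tells whether $v^i$ accepts the rumor. With independent thresholds $\theta_v$ uniform on $[0,1]$, let $f(S)$ be the expected number of users $v$ with $\sum_i w^i(1-r(v^i))\ge\theta_v$. For an integer $k$ with $1\le k\le n-n_r$ let $\mathrm{OPT}=\max\{f(S): S\subseteq V\setminus S_r,\ |S|\le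 k\}$. **Samples.** A Multi-Sampling is the random set $R$ obtained as follows: choose one of the $nr$ feature nodes $v^i$ uniformly, draw a realization of $G^i$, and search backwards along live edges breadth-first from $v^i$, level by level. If some level meets $S^i_r$, then $R$ consists of the nodes of all previous levels; if the search exhausts the nodes that reach $v^i$ without meeting $S_r^i$, then $R$ consists of all nodes of layer $i$. For a finite collection $\mathcal R$ of Multi-Samplings (with repetition) put $W_{\mathcal R}(S)=\frac1{|\mathcal R|}\sum_i w^i\,\#\{R\in\mathcal R: R\cap\{u^i:u\in S\}\neq\emptyset\}$. $\mathrm{NodeSelection}(\mathcal R,k)$ starts from $S=\emptyset$ and $k$ times adds to $S$ a user $u\in V\setminus S_r$ that maximizes $W_{\mathcal R}(S\cup\{u\})-W_{\mathcal R}(S)$, ties being broken by any fixed rule. **Procedure.** Let $\varepsilon,\ell>0$, $\varepsilon'=\sqrt2\,\varepsilon$, $\delta_3=\dfrac1{n^{\ell}\log_2(nr)}$ and $$\lambda'=\frac{nr\,(2\bar w+\tfrac23\varepsilon')\,\log\!\big(\tbinom{n-n_r}{k}/\delta_3\big)}{\varepsilon'^2},\qquad \lambda^*=\frac{2nr\,\bar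 w\,(2-\tfrac1e)\big(2-\tfrac1e+\tfrac{\varepsilon}{3\bar w}\big)\log\!\big(\tbinom{n-n_r}{k}\cdot 2n^{\ell}\big)}{\varepsilon^2}.$$ Start with $\mathcal R=\emptyset$ and $\mathrm{LB}=1$. For the integers $i=1,2,\dots$ with $i\le\log_2(nr)-1$: put $x_i=nr\cdot2^{-i}$; while $|\mathcal R|\le\lambda'/x_i$, insert a fresh independent Multi-Sampling into $\mathcal R$; let $S_i=\mathrm{NodeSelection}(\mathcal R,k)$; if $nr\cdot W_{\mathcal R}(S_i)\ge(1+\varepsilon')x_i$, set $\mathrm{LB}=nr\cdot W_{\mathcal R}(S_i)/(1+\varepsilon')$ and leave the loop. Finally start a new collection $\mathcal R'=\emptyset$ and, while $|\mathcal R'|\le\lambda^*/\mathrm{LB}$, insert fresh independent Multi-Samplings into $\mathcal R'$; return $\mathcal R'$. **Theorem 4.** The number of Multi-Samplings in the returned collection satisfies $|\mathcal R'|\ge\theta^*=\lambda^*/\mathrm{OPT}$ with probability at least $1-1/n^{\ell}$. -/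

import Mathlib

open scoped BigOperators

namespace MFRB

/-- An instance of multi-feature rumor blocking on the user set `V` with `r` features: a directed
graph, the activation probability of each edge in each layer, the weight of each feature, the
rumor seed users and, for each layer `i`, the rumor seed users whose copy in layer `i` accepts the
rumor (possibly not all of them). -/
structure Network (V : Type*) [Fintype V] [DecidableEq V] (r : ℕ) where
  edges : Finset (V × V)
  prob : Fin r → V × V → ℝ
  prob_nonneg : ∀ i, ∀ e ∈ edges, 0 ≤ prob i e
  prob_le_one : ∀ i, ∀ e ∈ edges, prob i e ≤ 1
  weight : Fin r → ℝ
  weight_nonneg : ∀ i, 0 ≤ weight i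
  weight_sum : ∑ i, weight i = 1
  rumor : Finset V
  rumorLayer : Fin r → Finset V
  rumorLayer_subset : ∀ i, rumorLayer i ⊆ rumor

/-! ### Two cascades on one realization of one layer -/

section Diffusion

variable {V : Type*} [Fintype V] [DecidableEq V]

/-- One round of the competitive diffusion along the live edges `g`. A state is the pair
(positive nodes, rumor nodes); a node keeps the first cascade that it accepts, and the rumor wins
when both arrive in the same round. -/
def diffusionStep (g : Finset (V × V)) (s : Finset V × Finset V) : Finset V × Finset V :=
  let rum := s.2 ∪ Finset.univ.filter fun v => v ∉ s.1 ∧ ∃ u ∈ s.2, (u, v) ∈ g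
  (s.1 ∪ Finset.univ.filter fun v => v ∉ rum ∧ ∃ u ∈ s.1, (u, v) ∈ g, rum)

/-- The state after `t` rounds, from positive seeds `P` and rumor seeds `Q`. -/
def diffusion (g : Finset (V × V)) (P Q : Finset V) (t : ℕ) : Finset V × Finset V :=
  (diffusionStep g)^[t] (P, Q)

/-- The node `v` accepts the rumor at some time. -/
def RumorAccepted (g : Finset (V × V)) (P Q : Finset V) (v : V) : Prop :=
  ∃ t, v ∈ (diffusion g P Q t).2

/-- The loop of R-sampling: a backward breadth-first search along live edges, with current
frontier `cur` and set `seen` of nodes already collected. It returns all nodes of the layer when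
the frontier is empty, and the nodes collected so far when the frontier meets the rumor set `Q`. -/
def rSamplingLoop (g : Finset (V × V)) (Q : Finset V) (cur seen : Finset V)
    (hdisj : Disjoint cur seen) : Finset V :=
  if hcur : cur = ∅ then Finset.univ
  else if (cur ∩ Q).Nonempty then seen
  else
    rSamplingLoop g Q
      (Finset.univ.filter fun t => (∃ u ∈ cur, (t, u) ∈ g) ∧ t ∉ seen ∪ cur) (seen ∪ cur)
      (Finset.disjoint_left.2 fun _ ht => (Finset.mem_filter.1 ht).2.2)
termination_by (Finset.univ \ seen).card
decreasing_by
  obtain ⟨a, ha⟩ := Finset.nonempty_iff_ne_empty.2 hcur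
  apply Finset.card_lt_card
  refine (Finset.ssubset_iff_of_subset ?_).2 ⟨a, ?_, ?_⟩
  · intro b hb
    simp only [Finset.mem_sdiff, Finset.mem_univ, Finset.mem_union, true_and] at hb ⊢
    exact fun h => hb (Or.inl h)
  · simpa using Finset.disjoint_left.1 hdisj ha
  · simp [ha]

/-- R-sampling from the node `v` on the realization `g` with rumor set `Q`. -/
def rSampling (g : Finset (V × V)) (v : V) (Q : Finset V) : Finset V :=
  rSamplingLoop g Q {v} ∅ (Finset.disjoint_empty_right _)

end Diffusion

noncomputable section

namespace Network

variable {V : Type*} [Fintype V] [DecidableEq V] {r : ℕ}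

/-- Number of feature nodes `n * r`, as a real number. -/
def nr (_N : Network V r) : ℝ := (Fintype.card V : ℝ) * (r : ℝ)

/-! ### Realizations and the objective -/

/-- The probability that exactly the edges in `g` are live in layer `i`. -/
def realizationProb (N : Network V r) (i : Fin r) (g : Finset (V × V)) : ℝ :=
  (∏ e ∈ g, N.prob i e) * ∏ e ∈ N.edges \ g, (1 - N.prob i e)

theorem realizationProb_nonneg (N : Network V r) (i : Fin r) {g : Finset (V × V)}
    (hg : g ⊆ N.edges) : 0 ≤ N.realizationProb i g :=
  mul_nonneg (Finset.prod_nonneg fun e he => N.prob_nonneg i e (hg he))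
    (Finset.prod_nonneg fun e he =>
      sub_nonneg.2 (N.prob_le_one i e (Finset.mem_sdiff.1 he).1))

theorem sum_realizationProb (N : Network V r) (i : Fin r) :
    ∑ g ∈ N.edges.powerset, N.realizationProb i g = 1 := by
  have h := Finset.prod_add (fun e => N.prob i e) (fun e => 1 - N.prob i e) N.edges
  simp only [add_sub_cancel, Finset.prod_const_one] at h
  exact h.symm

/-- A random realization of layer `i`. -/
def realization (N : Network V r) (i : Fin r) : PMF (Finset (V × V)) :=
  PMF.ofFinset
    (fun g => if g ⊆ N.edges then ENNReal.ofReal (N.realizationProb i g) else 0)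
    N.edges.powerset
    (by
      rw [Finset.sum_congr rfl fun g hg => if_pos (Finset.mem_powerset.1 hg),
        ← ENNReal.ofReal_sum_of_nonneg fun g hg =>
          N.realizationProb_nonneg i (Finset.mem_powerset.1 hg),
        N.sum_realizationProb i, ENNReal.ofReal_one])
    (fun _ hg => if_neg fun h => hg (Finset.mem_powerset.2 h))

open Classical in
/-- `r(vⁱ)`: whether the copy of user `v` in layer `i` accepts the rumor, when `g i` is the
realization of layer `i` and `S` is the positive seed set (fully active in every layer). -/
def rumorInd (N : Network V r) (g : Fin r → Finset (V × V)) (S : Finset V) (i : Fin r) (v : V) :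
    ℝ :=
  if RumorAccepted (g i) S (N.rumorLayer i) v then 1 else 0

open Classical in
/-- The number of users not activated by the rumor, for realizations `g` and thresholds `τ`. -/
def numNotRumorActive (N : Network V r) (S : Finset V) (g : Fin r → Finset (V × V))
    (τ : V → unitInterval) : ℕ :=
  (Finset.univ.filter fun v =>
    (τ v : ℝ) ≤ ∑ i, N.weight i * (1 - N.rumorInd g S i v)).card

/-- The expected number of users not activated by the rumor: the layers have independent
realizations and the thresholds are independent and uniform on `[0, 1]`. -/
def objective (N : Network V r) (S : Finset V) : ℝ :=
  ∑ g ∈ Fintype.piFinset fun _ : Fin r => N.edges.powerset,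
    (∏ i, N.realizationProb i (g i)) *
      ∫ τ : V → unitInterval, (N.numNotRumorActive S g τ : ℝ)

/-- The feasible positive seed sets for budget `k`. -/
def feasible (N : Network V r) (k : ℕ) : Finset (Finset V) :=
  (Finset.univ \ N.rumor).powerset.filter fun S => S.card ≤ k

theorem feasible_nonempty (N : Network V r) (k : ℕ) : (N.feasible k).Nonempty :=
  ⟨∅, by simp [feasible]⟩

/-- The optimal value of the rumor blocking problem with budget `k`. -/
def opt (N : Network V r) (k : ℕ) : ℝ :=
  (N.feasible k).sup' (N.feasible_nonempty k) N.objective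

/-! ### Multi-Sampling and greedy node selection -/

/-- Multi-Sampling: a uniform feature node, a random realization of its layer, and the R-sampling
from it, as a set of feature nodes (the pair `(i, v)` is the copy of user `v` in layer `i`). -/
def multiSampling [Nonempty V] [NeZero r] (N : Network V r) : PMF (Finset (Fin r × V)) :=
  (PMF.uniformOfFintype (Fin r × V)).bind fun a =>
    (N.realization a.1).map fun g => {a.1} ×ˢ rSampling g a.2 (N.rumorLayer a.1)

/-- `x(Sⁱ, R)`: whether the copy of `S` in layer `i` meets `R`. -/
def cover (_N : Network V r) (S : Finset V) (i : Fin r) (R : Finset (Fin r × V)) : ℝ :=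
  if (({i} ×ˢ S) ∩ R).Nonempty then 1 else 0

/-- The weighted average fraction of the samples in `L` covered by `S`. -/
def coverage (N : Network V r) (L : List (Finset (Fin r × V))) (S : Finset V) : ℝ :=
  1 / (L.length : ℝ) * ∑ i, N.weight i * (L.map (N.cover S i)).sum

/-- `pick L S` is, for all samples `L` and current seed sets `S`, a user outside the rumor set with
the largest marginal gain: an argmax with some way of breaking ties. -/
def IsArgmaxRule (N : Network V r)
    (pick : List (Finset (Fin r × V)) → Finset V → V) : Prop :=
  ∀ L S, pick L S ∉ N.rumor ∧ ∀ u, u ∉ N.rumor →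
    N.coverage L (insert u S) - N.coverage L S ≤
      N.coverage L (insert (pick L S) S) - N.coverage L S

/-- Greedy node selection: start from `∅` and add the picked user `k` times. -/
def nodeSelection (_N : Network V r) (pick : List (Finset (Fin r × V)) → Finset V → V) (k : ℕ)
    (L : List (Finset (Fin r × V))) : Finset V :=
  (fun S => insert (pick L S) S)^[k] ∅

/-! ### The adaptive sampling procedure -/

/-- While `|L| ≤ θ`, insert a fresh independent Multi-Sampling into `L`. -/
def fill [Nonempty V] [NeZero r] (N : Network V r) (θ : ℝ) (L : List (Finset (Fin r × V))) :
    PMF (List (Finset (Fin r × V))) :=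
  if _hθ : (L.length : ℝ) ≤ θ then N.multiSampling.bind fun R => fill N θ (R :: L)
  else PMF.pure L
termination_by ⌊θ⌋₊ + 1 - L.length
decreasing_by
  have h := Nat.le_floor _hθ
  simp only [List.length_cons]
  omega

/-- The largest feature weight. -/
def maxWeight [NeZero r] (N : Network V r) : ℝ :=
  Finset.univ.sup' Finset.univ_nonempty N.weight

/-- The number of size-`k` sets of users outside the rumor set. -/
def numSets (N : Network V r) (k : ℕ) : ℝ :=
  ((Fintype.card V - N.rumor.card).choose k : ℝ)

/-- The parameter `λ'`, where `ε'` is the error of the statistical test. -/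
def lambdaTest [NeZero r] (N : Network V r) (k : ℕ) (ε' δ₃ : ℝ) : ℝ :=
  N.nr * (2 * N.maxWeight + 2 / 3 * ε') * Real.log (N.numSets k / δ₃) / ε' ^ 2

/-- The parameter `λ*`. -/
def lambdaStar [NeZero r] (N : Network V r) (k : ℕ) (ε ℓ : ℝ) : ℝ :=
  2 * N.nr * N.maxWeight * (2 - 1 / Real.exp 1) *
    (2 - 1 / Real.exp 1 + ε / (3 * N.maxWeight)) *
    Real.log (N.numSets k * (2 * (Fintype.card V : ℝ) ^ ℓ)) / ε ^ 2

/-- The guess `x_i = nr / 2 ^ i`. -/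
def guess (N : Network V r) (i : ℕ) : ℝ := N.nr / 2 ^ i

/-- The for-loop that estimates the lower bound. The first numerical argument is the number of
iterations left, `i` is the current iteration and `L` is the collection drawn so far. The result is
the value of `LB` at the end of the loop. -/
def lowerBoundLoop [Nonempty V] [NeZero r] (N : Network V r)
    (pick : List (Finset (Fin r × V)) → Finset V → V) (k : ℕ) (ε' δ₃ : ℝ) :
    ℕ → ℕ → List (Finset (Fin r × V)) → PMF ℝ
  | 0, _, _ => PMF.pure 1
  | m + 1, i, L =>
    (N.fill (N.lambdaTest k ε' δ₃ / N.guess i) L).bind fun L' =>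
      let est := N.nr * N.coverage L' (N.nodeSelection pick k L')
      if (1 + ε') * N.guess i ≤ est then PMF.pure (est / (1 + ε'))
      else lowerBoundLoop N pick k ε' δ₃ m (i + 1) L'

/-- The adaptive sampling procedure: with `ε' = √2 ε`, the loop runs over the integers
`1 ≤ i ≤ log₂ (nr) - 1`, and afterwards a new collection is drawn from scratch. -/
def sampling [Nonempty V] [NeZero r] (N : Network V r)
    (pick : List (Finset (Fin r × V)) → Finset V → V) (k : ℕ) (ε ℓ δ₃ : ℝ) :
    PMF (List (Finset (Fin r × V))) :=
  (N.lowerBoundLoop pick k (Real.sqrt 2 * ε) δ₃ ⌊Real.logb 2 N.nr - 1⌋₊ 1 []).bind fun LB =>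
    N.fill (N.lambdaStar k ε ℓ / LB) []

end Network

end

end MFRB

/-! The final collection always has more than λ*/LB members, so it suffices that `0 < LB ≤ OPT`
fails with probability at most 1/n^ℓ. There are at most log₂(nr) − 1 rounds, so it is enough that
each sets LB above OPT with probability at most δ₃. The default LB = 1 is harmless: a positive seed
never accepts the rumor, hence OPT ≥ 1 (`one_le_opt`).

One round: if S meets the backward search from vⁱ, then either no rumor seed reaches vⁱ or a path
from S is shorter than every path from a rumor seed; in both cases vⁱ rejects the rumor
(`not_rumorAccepted_of_mem_rSampling`). So for a fixed S the expected covered weight is at most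
f(S)/nr (`expect_gain_le`), and only this direction is needed. An overestimate forces nr·W(Sᵢ) ≥
(1+ε')·max(xᵢ, OPT). The greedy set depends on the samples, but it is contained in some k-set
outside the rumor set, whose objective is at most OPT. A Bernstein upper tail
(`expect_gain_tail_le`) and a union bound over the k-sets finish the round
(`expect_overestimate_le`); λ' is large enough for each tail to be at most δ₃ divided by the number
of k-sets.

Rounds share samples, and a later round runs only if the earlier tests failed. Nothing is
conditioned on this: the failure of the loop is bounded by the sum of the overestimate events, each
evaluated on the collection of a loop that never stops, which is a fixed number of independent
samples (`expect_lowerBoundLoop_le`). -/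

namespace MFRB

/-! ### Bounded-length paths into a node -/

section Near

variable {V : Type*}

/-- There is a path with fewer than `d` edges, all in `g`, from the second node to `v`. -/
def Near (g : Finset (V × V)) (v : V) : ℕ → V → Prop
  | 0, _ => False
  | d + 1, y => y = v ∨ ∃ z, (y, z) ∈ g ∧ Near g v d z

theorem Near.succ {g : Finset (V × V)} {v : V} {d : ℕ} {y : V} (h : Near g v d y) :
    Near g v (d + 1) y := by
  induction d generalizing y with
  | zero => exact h.elim
  | succ d ih =>
    rcases h with rfl | ⟨z, hz, h⟩
    · exact Or.inl rfl
    · exact Or.inr ⟨z, hz, ih h⟩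

/-- Once a search level adds no node, no later level does. This turns an exhausted search into a
statement about paths of every length. -/
theorem near_of_near_stable {g : Finset (V × V)} {v : V} {d : ℕ}
    (h : ∀ y, Near g v (d + 1) y → Near g v d y) (e : ℕ) {y : V} (hy : Near g v e y) :
    Near g v d y := by
  induction e generalizing y with
  | zero => exact hy.elim
  | succ e ih =>
    rcases hy with rfl | ⟨z, hz, hy⟩
    · exact h _ (Or.inl rfl)
    · exact h _ (Or.inr ⟨z, hz, ih hy⟩)

end Near

/-! ### The backward search compared with the two cascades -/

section Diffusion

variable {V : Type*} [Fintype V] [DecidableEq V]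

/-- The hypotheses are the loop invariant after `d` levels: `seen` is the ball of paths with fewer
than `d` edges, the frontier completes the next ball, and no rumor seed has been collected. -/
theorem mem_rSamplingLoop (g : Finset (V × V)) (v : V) (Q cur seen : Finset V)
    (hdisj : Disjoint cur seen) (d : ℕ) (hseen : ∀ y, y ∈ seen ↔ Near g v d y)
    (hcur : ∀ y, y ∈ seen ∪ cur ↔ Near g v (d + 1) y) (hQ : ∀ q ∈ Q, ¬ Near g v d q)
    {x : V} (hx : x ∈ rSamplingLoop g Q cur seen hdisj) :
    (∃ e, Near g v e x ∧ ∀ q ∈ Q, ¬ Near g v e q) ∨ ∀ e, ∀ q ∈ Q, ¬ Near g v e q := by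
  induction cur, seen, hdisj using rSamplingLoop.induct g Q generalizing d with
  | case1 seen h =>
    right
    intro e q hq hn
    -- An empty frontier makes two consecutive balls equal, so a rumor seed at any distance would
    -- already lie in `seen`.
    refine hQ q hq (near_of_near_stable (fun y hy => ?_) e hn)
    have := (hcur y).2 hy
    rw [Finset.union_empty] at this
    exact (hseen y).1 this
  | case2 cur seen hdisj hne hmeet =>
    rw [rSamplingLoop, dif_neg hne, if_pos hmeet] at hx
    exact Or.inl ⟨d, (hseen x).1 hx, hQ⟩
  | case3 cur seen hdisj hne hmeet ih =>
    rw [rSamplingLoop, dif_neg hne, if_neg hmeet] at hx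
    refine ih (d + 1) hcur (fun y => ?_) (fun q hq hn => ?_) hx
    · constructor
      · intro hy
        rcases Finset.mem_union.1 hy with hy | hy
        · exact ((hcur y).1 hy).succ
        · obtain ⟨-, ⟨u, hu, hg⟩, -⟩ := Finset.mem_filter.1 hy
          exact Or.inr ⟨u, hg, (hcur u).1 (Finset.mem_union_right _ hu)⟩
      · intro hy
        by_cases hin : y ∈ seen ∪ cur
        · exact Finset.mem_union_left _ hin
        · refine Finset.mem_union_right _ (Finset.mem_filter.2 ⟨Finset.mem_univ _, ?_, hin⟩)
          rcases hy with rfl | ⟨z, hz, hy⟩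
          · exact (hin ((hcur _).2 (Or.inl rfl))).elim
          · rcases Finset.mem_union.1 ((hcur z).2 hy) with hz' | hz'
            · exact (hin ((hcur y).2 (Or.inr ⟨z, hz, (hseen z).1 hz'⟩))).elim
            · exact ⟨z, hz', hz⟩
    · rcases Finset.mem_union.1 ((hcur q).2 hn) with h | h
      · exact hQ q hq ((hseen q).1 h)
      · exact hmeet ⟨q, Finset.mem_inter.2 ⟨h, hq⟩⟩

theorem mem_rSampling {g : Finset (V × V)} {v : V} {Q : Finset V} {x : V}
    (hx : x ∈ rSampling g v Q) :
    (∃ e, Near g v e x ∧ ∀ q ∈ Q, ¬ Near g v e q) ∨ ∀ e, ∀ q ∈ Q, ¬ Near g v e q :=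
  mem_rSamplingLoop g v Q {v} ∅ _ 0 (fun y => by simp [Near]) (fun y => by simp [Near])
    (fun _ _ h => h) hx

theorem diffusion_succ (g : Finset (V × V)) (P Q : Finset V) (t : ℕ) :
    diffusion g P Q (t + 1) = diffusionStep g (diffusion g P Q t) :=
  Function.iterate_succ_apply' _ _ _

/-- The rumor crosses one edge per round, so `t` rounds trace back to a seed at most `t` edges
farther from `v`. -/
theorem exists_near_of_mem_diffusion_snd {g : Finset (V × V)} {P Q : Finset V} {v y : V}
    {t d : ℕ} (hy : y ∈ (diffusion g P Q t).2) (hd : Near g v d y) :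
    ∃ q ∈ Q, Near g v (d + t) q := by
  induction t generalizing y d with
  | zero => exact ⟨y, hy, hd⟩
  | succ t ih =>
    rw [diffusion_succ] at hy
    rcases Finset.mem_union.1 hy with hy | hy
    · obtain ⟨q, hq, h⟩ := ih hy hd
      exact ⟨q, hq, h.succ⟩
    · obtain ⟨-, -, u, hu, hg⟩ := Finset.mem_filter.1 hy
      obtain ⟨q, hq, h⟩ := ih hu (d := d + 1) (Or.inr ⟨y, hg, hd⟩)
      exact ⟨q, hq, by rwa [Nat.add_right_comm] at h⟩

theorem disjoint_diffusion {g : Finset (V × V)} {P Q : Finset V} (h : Disjoint P Q) (t : ℕ) :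
    Disjoint (diffusion g P Q t).1 (diffusion g P Q t).2 := by
  induction t with
  | zero => exact h
  | succ t ih =>
    rw [diffusion_succ]
    rw [Finset.disjoint_left] at ih ⊢
    intro y hy hy'
    rcases Finset.mem_union.1 hy with hy | hy
    · rcases Finset.mem_union.1 hy' with hy' | hy'
      · exact ih hy hy'
      · exact (Finset.mem_filter.1 hy').2.1 hy
    · exact (Finset.mem_filter.1 hy).2.1 hy'

theorem diffusion_fst_mono (g : Finset (V × V)) (P Q : Finset V) :
    Monotone fun t => (diffusion g P Q t).1 :=
  monotone_nat_of_le_succ fun t => by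
    rw [diffusion_succ]
    exact Finset.subset_union_left

theorem diffusion_snd_mono (g : Finset (V × V)) (P Q : Finset V) :
    Monotone fun t => (diffusion g P Q t).2 :=
  monotone_nat_of_le_succ fun t => by
    rw [diffusion_succ]
    exact Finset.subset_union_left

/-- A node that the positive cascade reaches along a path, with all the rumor seeds farther away,
is eventually positive. -/
theorem exists_mem_diffusion_fst {g : Finset (V × V)} {P Q : Finset V} {v x : V} {d t : ℕ}
    (hx : x ∈ (diffusion g P Q t).1) (hd : Near g v d x)
    (hQ : ∀ q ∈ Q, ¬ Near g v (d + t) q) : ∃ s, v ∈ (diffusion g P Q s).1 := by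
  induction d generalizing x t with
  | zero => exact hd.elim
  | succ d ih =>
    rcases hd with rfl | ⟨z, hz, hd⟩
    · exact ⟨t, hx⟩
    -- One edge along the path costs one round, so the rumor-free radius `d + t` is preserved. A
    -- rumor at `z` by then would trace back to a seed inside it.
    · refine ih (x := z) (t := t + 1) ?_ hd (fun q hq => by
        have := hQ q hq
        rwa [Nat.add_right_comm] at this)
      have hnot : z ∉ (diffusion g P Q (t + 1)).2 := fun hmem => by
        obtain ⟨q, hq, h⟩ := exists_near_of_mem_diffusion_snd hmem hd
        exact hQ q hq (by rwa [Nat.add_right_comm])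
      rw [diffusion_succ] at hnot ⊢
      exact Finset.mem_union_right _
        (Finset.mem_filter.2 ⟨Finset.mem_univ _, hnot, x, hx, hz⟩)

theorem not_rumorAccepted_of_mem_diffusion_fst {g : Finset (V × V)} {P Q : Finset V} {v : V}
    (h : Disjoint P Q) {s : ℕ} (hv : v ∈ (diffusion g P Q s).1) : ¬ RumorAccepted g P Q v := by
  rintro ⟨t, ht⟩
  exact Finset.disjoint_left.1 (disjoint_diffusion h (max s t))
    (diffusion_fst_mono g P Q (le_max_left s t) hv)
    (diffusion_snd_mono g P Q (le_max_right s t) ht)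

/-- If the positive seeds meet the R-sampling from `v`, then `v` does not accept the rumor. -/
theorem not_rumorAccepted_of_mem_rSampling {g : Finset (V × V)} {P Q : Finset V} {v x : V}
    (h : Disjoint P Q) (hxP : x ∈ P) (hx : x ∈ rSampling g v Q) : ¬ RumorAccepted g P Q v := by
  rcases mem_rSampling hx with ⟨e, hxe, hQ⟩ | hQ
  · obtain ⟨s, hs⟩ := exists_mem_diffusion_fst (t := 0) (P := P) hxP hxe hQ
    exact not_rumorAccepted_of_mem_diffusion_fst h hs
  · rintro ⟨t, ht⟩
    obtain ⟨q, hq, hn⟩ := exists_near_of_mem_diffusion_snd ht (d := 1) (v := v) (Or.inl rfl)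
    exact hQ _ q hq hn

end Diffusion
end MFRB

/-! ### Expectations and independent samples -/

open scoped ENNReal

namespace PMF

variable {α β : Type*}

/-- The expectation of an extended nonnegative function. -/
noncomputable def expect (p : PMF α) (f : α → ℝ≥0∞) : ℝ≥0∞ := ∑' a, p a * f a

theorem expect_pure (a : α) (f : α → ℝ≥0∞) : (PMF.pure a).expect f = f a := by
  rw [expect, tsum_eq_single a fun b hb => by simp [hb]]
  simp

theorem expect_bind (p : PMF α) (q : α → PMF β) (f : β → ℝ≥0∞) :
    (p.bind q).expect f = p.expect fun a => (q a).expect f := by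
  simp only [expect, bind_apply, ← ENNReal.tsum_mul_right, ← ENNReal.tsum_mul_left]
  rw [ENNReal.tsum_comm]
  simp only [mul_assoc]

theorem expect_map (p : PMF α) (q : α → β) (f : β → ℝ≥0∞) :
    (p.map q).expect f = p.expect fun a => f (q a) := by
  rw [← bind_pure_comp, expect_bind]
  simp [expect_pure]

theorem expect_mono (p : PMF α) {f g : α → ℝ≥0∞} (h : ∀ a, f a ≤ g a) :
    p.expect f ≤ p.expect g :=
  ENNReal.tsum_le_tsum fun a => mul_le_mul_right (h a) _

theorem expect_add (p : PMF α) (f g : α → ℝ≥0∞) :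
    (p.expect fun a => f a + g a) = p.expect f + p.expect g := by
  simp only [expect, mul_add, ENNReal.tsum_add]

theorem expect_mul_const (p : PMF α) (f : α → ℝ≥0∞) (c : ℝ≥0∞) :
    (p.expect fun a => f a * c) = p.expect f * c := by
  simp only [expect, ← mul_assoc, ENNReal.tsum_mul_right]

theorem expect_const (p : PMF α) (c : ℝ≥0∞) : (p.expect fun _ => c) = c := by
  simp only [expect, ENNReal.tsum_mul_right, p.tsum_coe, one_mul]

theorem expect_sum (p : PMF α) {ι : Type*} (s : Finset ι) (f : ι → α → ℝ≥0∞) :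
    (p.expect fun a => ∑ i ∈ s, f i a) = ∑ i ∈ s, p.expect (f i) := by
  classical
  induction s using Finset.induction_on with
  | empty => simp [expect]
  | insert i s hi ih => simp only [Finset.sum_insert hi, expect_add, ih]

theorem toOuterMeasure_eq_expect (p : PMF α) (s : Set α) :
    p.toOuterMeasure s = p.expect (s.indicator 1) := by
  rw [toOuterMeasure_apply, expect]
  refine tsum_congr fun a => ?_
  by_cases h : a ∈ s <;> simp [h]

theorem expect_indicator_compl (p : PMF α) (s : Set α) :
    p.expect (s.indicator 1) + p.expect (sᶜ.indicator 1) = 1 := by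
  rw [← expect_add]
  refine Eq.trans ?_ (p.expect_const 1)
  congr 1
  funext a
  by_cases h : a ∈ s <;> simp [h]

theorem expect_eq_sum [Fintype α] (p : PMF α) (f : α → ℝ≥0∞) : p.expect f = ∑ a, p a * f a :=
  tsum_fintype _

/-- The exponential Markov inequality. -/
theorem expect_indicator_exp_le (p : PMF α) (X : α → ℝ) (b : ℝ) :
    p.expect ({a | b ≤ X a}.indicator 1) ≤
      (p.expect fun a => ENNReal.ofReal (Real.exp (X a))) * ENNReal.ofReal (Real.exp (-b)) := by
  rw [← expect_mul_const]
  refine p.expect_mono fun a => ?_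
  by_cases h : b ≤ X a
  · rw [Set.indicator_of_mem (by exact h), ← ENNReal.ofReal_mul (Real.exp_pos _).le,
      ← Real.exp_add, Pi.one_apply, ← ENNReal.ofReal_one]
    exact ENNReal.ofReal_le_ofReal (Real.one_le_exp (by linarith))
  · rw [Set.indicator_of_notMem (by exact h)]
    exact zero_le

/-- Insert `j` independent samples of `p` into a list. -/
noncomputable def insertSamples (p : PMF α) : ℕ → List α → PMF (List α)
  | 0, L => PMF.pure L
  | j + 1, L => p.bind fun R => insertSamples p j (R :: L)

/-- Topping up to length `c` draws a number of samples that depends only on the length, so two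
consecutive batches merge into one of fixed size. -/
theorem insertSamples_bind (p : PMF α) (c j : ℕ) (L : List α) :
    ((p.insertSamples j L).bind fun L' => p.insertSamples (c - L'.length) L') =
      p.insertSamples (j + (c - (L.length + j))) L := by
  induction j generalizing L with
  | zero => simp [insertSamples]
  | succ j ih =>
    rw [Nat.add_right_comm, insertSamples, insertSamples, bind_bind]
    congr 1
    funext R
    rw [ih]
    simp only [List.length_cons, Nat.add_assoc, Nat.add_comm 1 j]

/-- Independence of the samples enters the exponential moments here. -/
theorem expect_insertSamples_prod (p : PMF α) (f : α → ℝ≥0∞) (j : ℕ) (L : List α) :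
    ((p.insertSamples j L).expect fun L' => (L'.map f).prod) =
      p.expect f ^ j * (L.map f).prod := by
  induction j generalizing L with
  | zero => simp [insertSamples, expect_pure]
  | succ j ih =>
    simp only [insertSamples, expect_bind, ih, List.map_cons, List.prod_cons]
    simp only [mul_comm (f _), ← mul_assoc]
    simp only [mul_comm _ (f _), expect_mul_const, pow_succ]
    ring

/-- Expectations over `j` inserted samples only depend on the lists with `j` more entries. -/
theorem expect_insertSamples_mono (p : PMF α) {f g : List α → ℝ≥0∞} (j : ℕ) (L : List α)
    (h : ∀ L', L'.length = L.length + j → f L' ≤ g L') :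
    (p.insertSamples j L).expect f ≤ (p.insertSamples j L).expect g := by
  induction j generalizing L with
  | zero =>
    simp only [insertSamples, expect_pure]
    exact h L rfl
  | succ j ih =>
    simp only [insertSamples, expect_bind]
    refine p.expect_mono fun R => ih _ fun L' hL' => h L' ?_
    rw [hL', List.length_cons]
    omega

end PMF

/-! ### Scalar inequalities for Bernstein's bound -/

/-- This is the [2/1] Padé approximant of `exp` as an upper bound. After division by `exp u`, the
monotonicity of `G` reduces to `1 + x + x²/2 ≤ exp x`. -/
theorem Real.exp_mul_le_quadratic {u : ℝ} (hu : 0 ≤ u) :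
    Real.exp u * (6 - 2 * u) ≤ 6 + 4 * u + u ^ 2 := by
  let G : ℝ → ℝ := fun u => (6 + 4 * u + u ^ 2) * Real.exp (-u) + 2 * u
  have hG : ∀ x, HasDerivAt G (2 - (2 + 2 * x + x ^ 2) * Real.exp (-x)) x := fun x => by
    have h1 : HasDerivAt (fun u : ℝ => 6 + 4 * u + u ^ 2) (4 + 2 * x) x := by
      have := (((hasDerivAt_id x).const_mul 4).const_add 6).add ((hasDerivAt_id x).pow 2)
      refine this.congr_deriv ?_
      simp
    have h2 : HasDerivAt (fun u : ℝ => Real.exp (-u)) (-Real.exp (-x)) x := by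
      refine (hasDerivAt_neg x).exp.congr_deriv ?_
      ring
    refine ((h1.mul h2).add ((hasDerivAt_id x).const_mul 2)).congr_deriv ?_
    ring
  have hmono : MonotoneOn G (Set.Ici 0) := by
    refine monotoneOn_of_deriv_nonneg (convex_Ici 0)
      (fun x _ => (hG x).continuousAt.continuousWithinAt)
      (fun x _ => (hG x).differentiableAt.differentiableWithinAt) fun x hx => ?_
    rw [interior_Ici] at hx
    rw [(hG x).deriv, Real.exp_neg, sub_nonneg, ← div_eq_mul_inv, div_le_iff₀ (Real.exp_pos x)]
    have := Real.quadratic_le_exp_of_nonneg (le_of_lt hx)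
    linarith
  have h := hmono Set.self_mem_Ici hu hu
  simp only [G, neg_zero, Real.exp_zero] at h
  have hpos := Real.exp_pos u
  have h' := mul_le_mul_of_nonneg_right h hpos.le
  have hc : Real.exp (-u) * Real.exp u = 1 := by rw [← Real.exp_add]; simp
  have : ((6 + 4 * u + u ^ 2) * Real.exp (-u) + 2 * u) * Real.exp u =
      6 + 4 * u + u ^ 2 + 2 * u * Real.exp u := by
    rw [add_mul, mul_assoc, hc, mul_one]
  nlinarith

/-- The exponent of Bernstein's inequality. -/
theorem Real.exists_exp_sub_le {c : ℝ} (hc : 0 < c) :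
    ∃ u, 0 < u ∧ Real.exp u - 1 - u * (1 + c) ≤ -(c ^ 2 / (2 + 2 / 3 * c)) := by
  -- For this `u < 3` the Padé denominator is positive and the bound equals the Bernstein exponent
  -- exactly.
  refine ⟨3 * c / (3 + c), by positivity, ?_⟩
  set u := 3 * c / (3 + c) with hu
  have h := Real.exp_mul_le_quadratic (u := u) (by positivity)
  have h6 : 6 - 2 * u = 18 / (3 + c) := by rw [hu]; field_simp; ring
  have hE : Real.exp u ≤ (6 + 4 * u + u ^ 2) / (6 - 2 * u) := by
    rw [le_div_iff₀ (by rw [h6]; positivity)]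
    exact h
  have : (6 + 4 * u + u ^ 2) / (6 - 2 * u) - 1 - u * (1 + c) = -(c ^ 2 / (2 + 2 / 3 * c)) := by
    rw [h6, hu]
    field_simp
    ring
  linarith

/-! ### The objective and the mean gain of a sample -/

open MeasureTheory in
theorem integral_card_filter_threshold_le {V : Type*} [Fintype V] (q : V → ℝ) (h0 : ∀ v, 0 ≤ q v)
    (h1 : ∀ v, q v ≤ 1) :
    ∫ τ : V → unitInterval, ((Finset.univ.filter fun v => (τ v : ℝ) ≤ q v).card : ℝ) =
      ∑ v, q v := by
  classical
  have key : ∀ v, MeasurableSet {τ : V → unitInterval | (τ v : ℝ) ≤ q v} := fun v =>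
    measurableSet_le (by fun_prop) measurable_const
  have heq : ∀ τ : V → unitInterval,
      ((Finset.univ.filter fun v => (τ v : ℝ) ≤ q v).card : ℝ) =
        ∑ v, {τ : V → unitInterval | (τ v : ℝ) ≤ q v}.indicator (fun _ => (1 : ℝ)) τ := fun τ => by
    rw [Finset.card_filter, Nat.cast_sum]
    exact Finset.sum_congr rfl fun v _ => by by_cases h : (τ v : ℝ) ≤ q v <;> simp [h]
  simp only [heq]
  rw [integral_finsetSum _ fun v _ => (integrable_const (1 : ℝ)).indicator (key v)]
  refine Finset.sum_congr rfl fun v _ => ?_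
  rw [integral_indicator (key v), setIntegral_const, smul_eq_mul, mul_one]
  lift q to V → unitInterval using fun v => Set.mem_Icc.2 ⟨h0 v, h1 v⟩
  have hset : {τ : V → unitInterval | (τ v : ℝ) ≤ q v} = Function.eval v ⁻¹' Set.Iic (q v) := by
    ext τ
    simp
  rw [hset, Measure.real, volume_pi, (measurePreserving_eval _ v).measure_preimage
    measurableSet_Iic.nullMeasurableSet, unitInterval.volume_Iic]
  exact ENNReal.toReal_ofReal (h0 v)

namespace MFRB
namespace Network
noncomputable section
variable {V : Type*} [Fintype V] [DecidableEq V] {r : ℕ}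

theorem expect_realization (N : Network V r) (i : Fin r) {f : Finset (V × V) → ℝ}
    (hf : ∀ g, 0 ≤ f g) :
    ((N.realization i).expect fun g => ENNReal.ofReal (f g)) =
      ENNReal.ofReal (∑ g ∈ N.edges.powerset, N.realizationProb i g * f g) := by
  rw [PMF.expect, ENNReal.ofReal_sum_of_nonneg fun g hg =>
    mul_nonneg (N.realizationProb_nonneg i (Finset.mem_powerset.1 hg)) (hf g)]
  rw [tsum_eq_sum (s := N.edges.powerset)]
  · refine Finset.sum_congr rfl fun g hg => ?_
    have hg' := Finset.mem_powerset.1 hg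
    rw [ENNReal.ofReal_mul (N.realizationProb_nonneg i hg'), realization, PMF.ofFinset_apply,
      if_pos hg']
  · intro g hg
    rw [realization, PMF.ofFinset_apply, if_neg fun h => hg (Finset.mem_powerset.2 h), zero_mul]

/-- The layers are independent: expanding a product of sums with `f` inserted only in factor `i`,
every other factor sums to 1. -/
theorem sum_piFinset_realizationProb_mul (N : Network V r) (i : Fin r)
    (f : Finset (V × V) → ℝ) :
    ∑ g ∈ Fintype.piFinset fun _ : Fin r => N.edges.powerset,
      (∏ j, N.realizationProb j (g j)) * f (g i) =
        ∑ g ∈ N.edges.powerset, N.realizationProb i g * f g := by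
  have h := Finset.prod_univ_sum (fun _ : Fin r => N.edges.powerset)
    (fun j g => N.realizationProb j g * if j = i then f g else 1)
  simp only [Finset.prod_mul_distrib, Finset.prod_ite_eq', Finset.mem_univ, if_true] at h
  rw [← h, Finset.prod_eq_single i]
  · simp
  · intro j _ hj
    simp [hj, N.sum_realizationProb j]
  · simp

theorem rumorInd_nonneg (N : Network V r) (g : Fin r → Finset (V × V)) (S : Finset V) (i : Fin r)
    (v : V) : 0 ≤ N.rumorInd g S i v := by
  unfold rumorInd
  split_ifs <;> norm_num

theorem rumorInd_le_one (N : Network V r) (g : Fin r → Finset (V × V)) (S : Finset V) (i : Fin r)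
    (v : V) : N.rumorInd g S i v ≤ 1 := by
  unfold rumorInd
  split_ifs <;> norm_num

theorem sum_weight_mul_rumorInd_nonneg (N : Network V r) (g : Fin r → Finset (V × V))
    (S : Finset V) (v : V) : 0 ≤ ∑ i, N.weight i * (1 - N.rumorInd g S i v) :=
  Finset.sum_nonneg fun i _ =>
    mul_nonneg (N.weight_nonneg i) (sub_nonneg.2 (N.rumorInd_le_one g S i v))

theorem sum_weight_mul_rumorInd_le_one (N : Network V r) (g : Fin r → Finset (V × V))
    (S : Finset V) (v : V) : ∑ i, N.weight i * (1 - N.rumorInd g S i v) ≤ 1 := by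
  exact (Finset.sum_le_sum fun i _ => mul_le_of_le_one_right (N.weight_nonneg i)
    (sub_le_self _ (N.rumorInd_nonneg g S i v))).trans N.weight_sum.le

theorem integral_numNotRumorActive (N : Network V r) (S : Finset V)
    (g : Fin r → Finset (V × V)) :
    ∫ τ : V → unitInterval, (N.numNotRumorActive S g τ : ℝ) =
      ∑ v, ∑ i, N.weight i * (1 - N.rumorInd g S i v) := by
  rw [← integral_card_filter_threshold_le _ (N.sum_weight_mul_rumorInd_nonneg g S)
    (N.sum_weight_mul_rumorInd_le_one g S)]
  refine MeasureTheory.integral_congr_ae (Filter.Eventually.of_forall fun τ => ?_)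
  simp only [numNotRumorActive]

/-- The objective is the sum over the feature nodes of the weighted probabilities of not accepting
the rumor. -/
theorem objective_eq (N : Network V r) (S : Finset V) :
    N.objective S = ∑ a : Fin r × V, ∑ g ∈ N.edges.powerset,
      N.realizationProb a.1 g * (N.weight a.1 * (1 - N.rumorInd (fun _ => g) S a.1 a.2)) := by
  unfold objective
  simp only [integral_numNotRumorActive, Finset.mul_sum]
  rw [Finset.sum_comm, Fintype.sum_prod_type_right]
  refine Finset.sum_congr rfl fun v _ => ?_
  rw [Finset.sum_comm]
  exact Finset.sum_congr rfl fun i _ => N.sum_piFinset_realizationProb_mul i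
    fun g => N.weight i * (1 - N.rumorInd (fun _ => g) S i v)

/-- The weight of the layers in which `S` covers the sample `R`. -/
def gain (N : Network V r) (S : Finset V) (R : Finset (Fin r × V)) : ℝ :=
  ∑ i, N.weight i * N.cover S i R

theorem cover_nonneg (N : Network V r) (S : Finset V) (i : Fin r) (R : Finset (Fin r × V)) :
    0 ≤ N.cover S i R := by
  unfold cover
  split_ifs <;> norm_num

theorem cover_mono (N : Network V r) {S T : Finset V} (h : S ⊆ T) (i : Fin r)
    (R : Finset (Fin r × V)) : N.cover S i R ≤ N.cover T i R := by
  unfold cover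
  split_ifs with h1 h2
  · exact le_rfl
  · exact (h2 (h1.mono (Finset.inter_subset_inter_right
      (Finset.product_subset_product_right h)))).elim
  · norm_num
  · exact le_rfl

theorem gain_nonneg (N : Network V r) (S : Finset V) (R : Finset (Fin r × V)) :
    0 ≤ N.gain S R :=
  Finset.sum_nonneg fun i _ => mul_nonneg (N.weight_nonneg i) (N.cover_nonneg S i R)

theorem gain_mono (N : Network V r) {S T : Finset V} (h : S ⊆ T) (R : Finset (Fin r × V)) :
    N.gain S R ≤ N.gain T R :=
  Finset.sum_le_sum fun i _ => mul_le_mul_of_nonneg_left (N.cover_mono h i R) (N.weight_nonneg i)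

theorem coverage_eq (N : Network V r) (L : List (Finset (Fin r × V))) (S : Finset V) :
    N.coverage L S = (L.map (N.gain S)).sum / L.length := by
  rw [coverage, one_div, inv_mul_eq_div]
  congr 1
  induction L with
  | nil => simp
  | cons R L ih => simp only [List.map_cons, List.sum_cons, ← ih, gain, mul_add,
      Finset.sum_add_distrib]

theorem coverage_mono (N : Network V r) (L : List (Finset (Fin r × V))) {S T : Finset V}
    (h : S ⊆ T) : N.coverage L S ≤ N.coverage L T := by
  rw [coverage_eq, coverage_eq]
  exact div_le_div_of_nonneg_right (List.sum_le_sum fun R _ => N.gain_mono h R) (Nat.cast_nonneg _)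

theorem gain_singleton_product (N : Network V r) (S : Finset V) (i : Fin r) (A : Finset V) :
    N.gain S ({i} ×ˢ A) = N.weight i * if (S ∩ A).Nonempty then 1 else 0 := by
  rw [gain, Finset.sum_eq_single i]
  · rw [cover, ← Finset.product_inter]
    simp
  · intro j _ hj
    rw [cover, if_neg, mul_zero]
    rintro ⟨x, hx⟩
    rw [Finset.mem_inter, Finset.mem_product, Finset.mem_product, Finset.mem_singleton,
      Finset.mem_singleton] at hx
    exact hj (hx.1.1.symm.trans hx.2.1)
  · simp

theorem gain_rSampling_le (N : Network V r) {S : Finset V} (hS : Disjoint S N.rumor)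
    (i : Fin r) (v : V) (g : Finset (V × V)) :
    N.gain S ({i} ×ˢ rSampling g v (N.rumorLayer i)) ≤
      N.weight i * (1 - N.rumorInd (fun _ => g) S i v) := by
  rw [gain_singleton_product]
  refine mul_le_mul_of_nonneg_left ?_ (N.weight_nonneg i)
  split_ifs with h
  · obtain ⟨x, hx⟩ := h
    rw [Finset.mem_inter] at hx
    rw [rumorInd, if_neg (not_rumorAccepted_of_mem_rSampling
      (hS.mono_right (N.rumorLayer_subset i)) hx.1 hx.2), sub_zero]
  · exact sub_nonneg.2 (N.rumorInd_le_one _ S i v)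

theorem nr_pos [Nonempty V] [NeZero r] (N : Network V r) : 0 < N.nr :=
  mul_pos (Nat.cast_pos.2 Fintype.card_pos) (Nat.cast_pos.2 (Nat.pos_of_ne_zero (NeZero.ne r)))

/-- The expected gain underestimates the objective. -/
theorem expect_gain_le [Nonempty V] [NeZero r] (N : Network V r) {S : Finset V}
    (hS : Disjoint S N.rumor) :
    (N.multiSampling.expect fun R => ENNReal.ofReal (N.gain S R)) ≤
      ENNReal.ofReal (N.objective S / N.nr) := by
  rw [multiSampling, PMF.expect_bind, PMF.expect_eq_sum, objective_eq, div_eq_inv_mul,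
    Finset.mul_sum, ENNReal.ofReal_sum_of_nonneg]
  · refine Finset.sum_le_sum fun a _ => ?_
    rw [ENNReal.ofReal_mul (inv_nonneg.2 N.nr_pos.le), PMF.expect_map]
    have hu : (PMF.uniformOfFintype (Fin r × V)) a = ENNReal.ofReal N.nr⁻¹ := by
      rw [PMF.uniformOfFintype_apply, ENNReal.ofReal_inv_of_pos N.nr_pos, nr]
      congr 1
      rw [Fintype.card_prod, Fintype.card_fin, mul_comm, Nat.cast_mul,
        ENNReal.ofReal_mul (Nat.cast_nonneg _), ENNReal.ofReal_natCast, ENNReal.ofReal_natCast]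
    rw [hu]
    refine mul_le_mul_right ?_ _
    rw [← N.expect_realization a.1 fun g => mul_nonneg (N.weight_nonneg _)
      (sub_nonneg.2 (N.rumorInd_le_one _ S a.1 a.2))]
    exact PMF.expect_mono _ fun g =>
      ENNReal.ofReal_le_ofReal (N.gain_rSampling_le hS a.1 a.2 g)
  · intro a _
    exact mul_nonneg (inv_nonneg.2 N.nr_pos.le) (Finset.sum_nonneg fun g hg =>
      mul_nonneg (N.realizationProb_nonneg _ (Finset.mem_powerset.1 hg))
        (mul_nonneg (N.weight_nonneg _) (sub_nonneg.2 (N.rumorInd_le_one _ S a.1 a.2))))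

theorem one_le_objective (N : Network V r) {S : Finset V} (hS : Disjoint S N.rumor)
    (hne : S.Nonempty) : 1 ≤ N.objective S := by
  obtain ⟨u, hu⟩ := hne
  rw [objective_eq, Fintype.sum_prod_type_right]
  have hnonneg : ∀ a : Fin r × V, 0 ≤ ∑ g ∈ N.edges.powerset,
      N.realizationProb a.1 g * (N.weight a.1 * (1 - N.rumorInd (fun _ => g) S a.1 a.2)) :=
    fun a => Finset.sum_nonneg fun g hg =>
      mul_nonneg (N.realizationProb_nonneg _ (Finset.mem_powerset.1 hg))
        (mul_nonneg (N.weight_nonneg _) (sub_nonneg.2 (N.rumorInd_le_one _ S a.1 a.2)))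
  refine le_trans ?_ (Finset.single_le_sum
    (fun v _ => Finset.sum_nonneg fun i _ => hnonneg (i, v)) (Finset.mem_univ u))
  refine N.weight_sum.ge.trans (Finset.sum_le_sum fun i _ => ?_)
  have h : ∀ g, N.rumorInd (fun _ => g) S i u = 0 := fun g =>
    if_neg (not_rumorAccepted_of_mem_diffusion_fst (s := 0)
      (hS.mono_right (N.rumorLayer_subset i)) hu)
  simp only [h, sub_zero, mul_one, ← Finset.sum_mul, N.sum_realizationProb, one_mul, le_refl]

theorem disjoint_of_mem_feasible (N : Network V r) {k : ℕ} {S : Finset V}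
    (hS : S ∈ N.feasible k) : Disjoint S N.rumor :=
  Finset.disjoint_of_subset_left (Finset.mem_powerset.1 (Finset.mem_filter.1 hS).1)
    Finset.sdiff_disjoint

theorem objective_le_opt (N : Network V r) {k : ℕ} {S : Finset V} (hS : S ∈ N.feasible k) :
    N.objective S ≤ N.opt k :=
  Finset.le_sup' N.objective hS

theorem one_le_opt (N : Network V r) {k : ℕ} (hk : 1 ≤ k)
    (hkn : k ≤ Fintype.card V - N.rumor.card) : 1 ≤ N.opt k := by
  have hcard : 0 < (Finset.univ \ N.rumor).card := by
    rw [Finset.card_sdiff_of_subset (Finset.subset_univ _), Finset.card_univ]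
    omega
  obtain ⟨u, hu⟩ := Finset.card_pos.1 hcard
  have hf : {u} ∈ N.feasible k := Finset.mem_filter.2
    ⟨Finset.mem_powerset.2 (Finset.singleton_subset_iff.2 hu), by simpa using hk⟩
  exact (N.one_le_objective (N.disjoint_of_mem_feasible hf) (Finset.singleton_nonempty u)).trans
    (N.objective_le_opt hf)

end
end Network
end MFRB

/-! ### Concentration of the sampled gain -/

namespace MFRB
namespace Network
noncomputable section
variable {V : Type*} [Fintype V] [DecidableEq V] {r : ℕ}

section Tail

variable [NeZero r]

theorem weight_le_maxWeight (N : Network V r) (i : Fin r) : N.weight i ≤ N.maxWeight :=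
  Finset.le_sup' N.weight (Finset.mem_univ i)

theorem maxWeight_le_one (N : Network V r) : N.maxWeight ≤ 1 :=
  Finset.sup'_le _ _ fun i _ =>
    (Finset.single_le_sum (fun j _ => N.weight_nonneg j) (Finset.mem_univ i)).trans N.weight_sum.le

theorem maxWeight_pos (N : Network V r) : 0 < N.maxWeight := by
  by_contra! h
  have h0 : ∑ i, N.weight i ≤ 0 :=
    Finset.sum_nonpos fun i _ => (N.weight_le_maxWeight i).trans h
  rw [N.weight_sum] at h0
  linarith

/-- A sample lives in one layer, so its gain lies in `[0, maxWeight]`, where convexity puts `exp`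
below its chord. This is how `maxWeight` enters the tail exponent. -/
theorem exp_gain_le (N : Network V r) (S : Finset V) {u : ℝ} (i : Fin r) (A : Finset V) :
    Real.exp (u / N.maxWeight * N.gain S ({i} ×ˢ A)) ≤
      1 + N.gain S ({i} ×ˢ A) * ((Real.exp u - 1) / N.maxWeight) := by
  have hw := N.maxWeight_pos
  have h0 := N.gain_nonneg S ({i} ×ˢ A)
  have h1 : N.gain S ({i} ×ˢ A) ≤ N.maxWeight := by
    rw [gain_singleton_product]
    refine le_trans (mul_le_of_le_one_right (N.weight_nonneg i) ?_) (N.weight_le_maxWeight i)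
    split_ifs <;> norm_num
  set x := N.gain S ({i} ×ˢ A)
  have h := convexOn_exp.2 (Set.mem_univ u) (Set.mem_univ 0) (div_nonneg h0 hw.le)
    (sub_nonneg.2 (div_le_one_of_le₀ h1 hw.le)) (add_sub_cancel _ _)
  simp only [smul_eq_mul, mul_zero, add_zero, Real.exp_zero, mul_one] at h
  have e1 : u / N.maxWeight * x = x / N.maxWeight * u := by ring
  have e2 : 1 + x * ((Real.exp u - 1) / N.maxWeight) =
    x / N.maxWeight * Real.exp u + (1 - x / N.maxWeight) := by ring
  rw [e1, e2]
  exact h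

variable [Nonempty V]

theorem expect_multiSampling_mono (N : Network V r) {f h : Finset (Fin r × V) → ℝ≥0∞}
    (hfh : ∀ i A, f ({i} ×ˢ A) ≤ h ({i} ×ˢ A)) :
    N.multiSampling.expect f ≤ N.multiSampling.expect h := by
  rw [multiSampling, PMF.expect_bind, PMF.expect_bind]
  refine PMF.expect_mono _ fun a => ?_
  rw [PMF.expect_map, PMF.expect_map]
  exact PMF.expect_mono _ fun g => hfh _ _

/-- As `u ≥ 0`, an upper bound `y` on the mean suffices; `1 + t ≤ exp t` then gives a Poisson-type
moment bound. -/
theorem expect_exp_gain_le (N : Network V r) {S : Finset V} (hS : Disjoint S N.rumor) {u y : ℝ}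
    (hu : 0 ≤ u) (hy : 0 ≤ y) (hSy : N.objective S / N.nr ≤ y) :
    (N.multiSampling.expect fun R =>
      ENNReal.ofReal (Real.exp (u / N.maxWeight * N.gain S R))) ≤
        ENNReal.ofReal (Real.exp (y / N.maxWeight * (Real.exp u - 1))) := by
  have hc : 0 ≤ (Real.exp u - 1) / N.maxWeight :=
    div_nonneg (sub_nonneg.2 (Real.one_le_exp hu)) N.maxWeight_pos.le
  calc _ ≤ N.multiSampling.expect fun R =>
        1 + ENNReal.ofReal (N.gain S R) * ENNReal.ofReal ((Real.exp u - 1) / N.maxWeight) :=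
        N.expect_multiSampling_mono fun i A => by
          rw [← ENNReal.ofReal_mul (N.gain_nonneg _ _), ← ENNReal.ofReal_one,
            ← ENNReal.ofReal_add zero_le_one (mul_nonneg (N.gain_nonneg _ _) hc)]
          exact ENNReal.ofReal_le_ofReal (N.exp_gain_le S i A)
    _ ≤ 1 + ENNReal.ofReal y * ENNReal.ofReal ((Real.exp u - 1) / N.maxWeight) := by
        rw [PMF.expect_add, PMF.expect_const, PMF.expect_mul_const]
        gcongr
        exact (N.expect_gain_le hS).trans (ENNReal.ofReal_le_ofReal hSy)
    _ ≤ _ := by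
        rw [← ENNReal.ofReal_mul hy, ← ENNReal.ofReal_one,
          ← ENNReal.ofReal_add zero_le_one (mul_nonneg hy hc)]
        refine ENNReal.ofReal_le_ofReal (le_trans (le_of_eq ?_) (Real.add_one_le_exp _))
        ring

/-- Bernstein's inequality for the upper tail of the total gain of `j` samples. -/
theorem expect_gain_tail_le (N : Network V r) {S : Finset V} (hS : Disjoint S N.rumor) {c y : ℝ}
    (hc : 0 < c) (hy : 0 ≤ y) (hSy : N.objective S / N.nr ≤ y) (j : ℕ) :
    (N.multiSampling.insertSamples j []).expect
      ({L | j * y * (1 + c) ≤ (L.map (N.gain S)).sum}.indicator 1) ≤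
        ENNReal.ofReal (Real.exp (-(j * y / N.maxWeight * (c ^ 2 / (2 + 2 / 3 * c))))) := by
  obtain ⟨u, hu, hbound⟩ := Real.exists_exp_sub_le hc
  have hw := N.maxWeight_pos
  have hset : {L : List (Finset (Fin r × V)) | j * y * (1 + c) ≤ (L.map (N.gain S)).sum} =
      {L | u / N.maxWeight * (j * y * (1 + c)) ≤
        u / N.maxWeight * (L.map (N.gain S)).sum} := by
    ext L
    exact (mul_le_mul_iff_right₀ (div_pos hu hw)).symm
  have hprod : ∀ L : List (Finset (Fin r × V)),
      ENNReal.ofReal (Real.exp (u / N.maxWeight * (L.map (N.gain S)).sum)) =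
        (L.map fun R => ENNReal.ofReal (Real.exp (u / N.maxWeight * N.gain S R))).prod := by
    intro L
    induction L with
    | nil => simp
    | cons R L ih => rw [List.map_cons, List.map_cons, List.sum_cons, List.prod_cons, mul_add,
        Real.exp_add, ENNReal.ofReal_mul (Real.exp_pos _).le, ih]
  rw [hset]
  refine (PMF.expect_indicator_exp_le _ _ _).trans ?_
  simp only [hprod]
  rw [PMF.expect_insertSamples_prod, List.map_nil, List.prod_nil, mul_one]
  refine (mul_le_mul_left (pow_le_pow_left' (N.expect_exp_gain_le hS hu.le hy hSy) j) _).trans ?_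
  rw [← ENNReal.ofReal_pow (Real.exp_pos _).le, ← ENNReal.ofReal_mul (by positivity),
    ← Real.exp_nat_mul, ← Real.exp_add]
  refine ENNReal.ofReal_le_ofReal (Real.exp_le_exp.2 ?_)
  -- The total exponent factors as `j * y / maxWeight` times `exp u - 1 - u * (1 + c)`.
  have h := mul_le_mul_of_nonneg_left hbound
    (div_nonneg (mul_nonneg (Nat.cast_nonneg j) hy) hw.le)
  refine le_trans (le_of_eq ?_) (h.trans (le_of_eq ?_)) <;> ring

end Tail

/-! ### Greedy selection and the error of one round -/

theorem nodeSelection_subset (N : Network V r)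
    {pick : List (Finset (Fin r × V)) → Finset V → V} (hpick : N.IsArgmaxRule pick) (k : ℕ)
    (L : List (Finset (Fin r × V))) :
    N.nodeSelection pick k L ⊆ Finset.univ \ N.rumor ∧ (N.nodeSelection pick k L).card ≤ k := by
  induction k with
  | zero => simp [nodeSelection]
  | succ k ih =>
    rw [nodeSelection, Function.iterate_succ_apply']
    refine ⟨Finset.insert_subset (by simpa using (hpick L _).1) ih.1, ?_⟩
    exact (Finset.card_insert_le _ _).trans (Nat.succ_le_succ ih.2)

theorem card_nonRumor (N : Network V r) :
    (Finset.univ \ N.rumor).card = Fintype.card V - N.rumor.card := by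
  rw [Finset.card_sdiff_of_subset (Finset.subset_univ _), Finset.card_univ]

/-- Picks may repeat, so the greedy set can be smaller than `k`. Padding it lets the union bound run
over exactly `numSets` sets. -/
theorem exists_coverage_nodeSelection_le (N : Network V r)
    {pick : List (Finset (Fin r × V)) → Finset V → V} (hpick : N.IsArgmaxRule pick) {k : ℕ}
    (hkn : k ≤ Fintype.card V - N.rumor.card) (L : List (Finset (Fin r × V))) :
    ∃ T ∈ (Finset.univ \ N.rumor).powersetCard k,
      N.coverage L (N.nodeSelection pick k L) ≤ N.coverage L T := by
  obtain ⟨hs, hc⟩ := N.nodeSelection_subset hpick k L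
  obtain ⟨T, hST, hT, hcard⟩ := Finset.exists_subsuperset_card_eq hs hc
    (by rwa [N.card_nonRumor])
  exact ⟨T, Finset.mem_powersetCard.2 ⟨hT, hcard⟩, N.coverage_mono L hST⟩

theorem numSets_eq (N : Network V r) (k : ℕ) :
    N.numSets k = ((Finset.univ \ N.rumor).powersetCard k).card := by
  rw [Finset.card_powersetCard, N.card_nonRumor, numSets]

theorem one_le_numSets (N : Network V r) {k : ℕ} (hkn : k ≤ Fintype.card V - N.rumor.card) :
    1 ≤ N.numSets k := by
  rw [numSets, Nat.one_le_cast]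
  exact Nat.choose_pos hkn

variable [Nonempty V] [NeZero r]

/-- The test `length ≤ θ` is not strict, so filling stops at `⌊θ⌋₊ + 1`, strictly above `θ`, unless
the list is already longer. -/
theorem fill_eq_insertSamples (N : Network V r) {θ : ℝ} (hθ : 0 ≤ θ)
    (L : List (Finset (Fin r × V))) :
    N.fill θ L = N.multiSampling.insertSamples (⌊θ⌋₊ + 1 - L.length) L := by
  induction h : ⌊θ⌋₊ + 1 - L.length generalizing L with
  | zero =>
    rw [fill, dif_neg, PMF.insertSamples]
    rw [← Nat.le_floor_iff hθ]
    omega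
  | succ d ih =>
    rw [fill, dif_pos, PMF.insertSamples]
    · congr 1
      funext R
      refine ih _ ?_
      rw [List.length_cons]
      omega
    · rw [← Nat.le_floor_iff hθ]
      omega

theorem log_le_exponent (N : Network V r) {k j : ℕ} {c δ x y : ℝ} (hc : 0 < c) (hx : 0 < x)
    (hlog : 0 ≤ Real.log (N.numSets k / δ)) (hj : N.lambdaTest k c δ / x ≤ j)
    (hy : x / N.nr ≤ y) :
    Real.log (N.numSets k / δ) ≤ j * y / N.maxWeight * (c ^ 2 / (2 + 2 / 3 * c)) := by
  have hw := N.maxWeight_pos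
  have hw1 := N.maxWeight_le_one
  have hn := N.nr_pos
  have h1 : N.lambdaTest k c δ / x * (x / N.nr) ≤ j * y :=
    mul_le_mul hj hy (div_pos hx hn).le (Nat.cast_nonneg j)
  have h2 : N.lambdaTest k c δ / x * (x / N.nr) =
      (2 * N.maxWeight + 2 / 3 * c) * Real.log (N.numSets k / δ) / c ^ 2 := by
    rw [lambdaTest]
    field_simp
  rw [h2] at h1
  calc Real.log (N.numSets k / δ)
      ≤ ((2 * N.maxWeight + 2 / 3 * c) / (N.maxWeight * (2 + 2 / 3 * c))) *
          Real.log (N.numSets k / δ) := by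
        -- Since `maxWeight ≤ 1`, the factor `2 * maxWeight + 2 / 3 * c` in λ' dominates the
        -- Bernstein factor `maxWeight * (2 + 2 / 3 * c)`.
        refine le_mul_of_one_le_left hlog ?_
        rw [one_le_div (by positivity)]
        nlinarith
    _ = (2 * N.maxWeight + 2 / 3 * c) * Real.log (N.numSets k / δ) / c ^ 2 / N.maxWeight *
          (c ^ 2 / (2 + 2 / 3 * c)) := by field_simp
    _ ≤ _ := by gcongr

/-- With enough samples, one round of the test rarely stops with a lower bound above the optimum. -/
theorem expect_overestimate_le (N : Network V r)
    {pick : List (Finset (Fin r × V)) → Finset V → V} (hpick : N.IsArgmaxRule pick) {k : ℕ}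
    (hkn : k ≤ Fintype.card V - N.rumor.card) {c δ x : ℝ} (hc : 0 < c) (hx : 0 < x)
    (hδ : 0 < δ) (hδ1 : δ ≤ 1) {j : ℕ} (hj0 : 0 < j) (hj : N.lambdaTest k c δ / x ≤ j) :
    (N.multiSampling.insertSamples j []).expect
      ({L | (1 + c) * x ≤ N.nr * N.coverage L (N.nodeSelection pick k L) ∧
        N.opt k < N.nr * N.coverage L (N.nodeSelection pick k L) / (1 + c)}.indicator 1) ≤
      ENNReal.ofReal δ := by
  have hn := N.nr_pos
  have hC := N.one_le_numSets hkn
  have hC0 : 0 < N.numSets k := by linarith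
  -- The maximum serves twice: `y ≥ x / nr` makes the sample size sufficient, and `y ≥ opt / nr`
  -- bounds the mean of every feasible set.
  set y := max x (N.opt k) / N.nr with hy
  have hy0 : 0 ≤ y := div_nonneg (hx.le.trans (le_max_left _ _)) hn.le
  have hlog : 0 ≤ Real.log (N.numSets k / δ) :=
    Real.log_nonneg ((one_le_div hδ).2 (hδ1.trans hC))
  have hexp := N.log_le_exponent hc hx hlog hj (y := y)
    (div_le_div_of_nonneg_right (le_max_left _ _) hn.le)
  calc _ ≤ (N.multiSampling.insertSamples j []).expect fun L =>
        ∑ T ∈ (Finset.univ \ N.rumor).powersetCard k,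
          {L | j * y * (1 + c) ≤ (L.map (N.gain T)).sum}.indicator 1 L := by
        refine PMF.expect_insertSamples_mono _ _ _ fun L hL => ?_
        rw [List.length_nil, zero_add] at hL
        refine Set.indicator_apply_le' (fun h => ?_) fun _ => zero_le
        obtain ⟨h1, h2⟩ := h
        obtain ⟨T, hT, hle⟩ := N.exists_coverage_nodeSelection_le hpick hkn L
        refine le_trans ?_ (Finset.single_le_sum
          (f := fun T => {L | j * y * (1 + c) ≤ (L.map (N.gain T)).sum}.indicator
            (1 : List (Finset (Fin r × V)) → ℝ≥0∞) L) (fun _ _ => zero_le) hT)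
        rw [Set.indicator_of_mem]
        rw [lt_div_iff₀ (by positivity)] at h2
        have hmax : max x (N.opt k) * (1 + c) ≤ N.nr * N.coverage L T := by
          refine le_trans ?_ (mul_le_mul_of_nonneg_left hle hn.le)
          rw [max_mul_of_nonneg _ _ (by positivity)]
          exact max_le (by linarith) h2.le
        have hj0' : (0 : ℝ) < j := Nat.cast_pos.2 hj0
        rw [N.coverage_eq, hL, mul_div_assoc', le_div_iff₀ hj0'] at hmax
        rw [Set.mem_ofPred_eq, hy, mul_div_assoc', div_mul_eq_mul_div, div_le_iff₀ hn]
        linarith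
    _ ≤ ∑ T ∈ (Finset.univ \ N.rumor).powersetCard k, ENNReal.ofReal (δ / N.numSets k) := by
        rw [PMF.expect_sum]
        refine Finset.sum_le_sum fun T hT => ?_
        obtain ⟨hT, hcard⟩ := Finset.mem_powersetCard.1 hT
        have hf : T ∈ N.feasible k :=
          Finset.mem_filter.2 ⟨Finset.mem_powerset.2 hT, hcard.le⟩
        refine (N.expect_gain_tail_le (N.disjoint_of_mem_feasible hf) hc hy0
          (div_le_div_of_nonneg_right ((N.objective_le_opt hf).trans (le_max_right _ _)) hn.le)
          j).trans (ENNReal.ofReal_le_ofReal ?_)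
        refine (Real.exp_le_exp.2 (neg_le_neg hexp)).trans (le_of_eq ?_)
        rw [Real.exp_neg, Real.exp_log (div_pos hC0 hδ), inv_div]
    _ = _ := by
        rw [Finset.sum_const, nsmul_eq_mul, ← ENNReal.ofReal_natCast, ← N.numSets_eq,
          ← ENNReal.ofReal_mul hC0.le, mul_div_cancel₀ _ hC0.ne']

/-! ### The estimation loop -/

theorem guess_pos (N : Network V r) (i : ℕ) : 0 < N.guess i :=
  div_pos N.nr_pos (by positivity)

theorem lambdaTest_nonneg (N : Network V r) {k : ℕ} {c δ : ℝ} (hc : 0 ≤ c)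
    (hlog : 0 ≤ Real.log (N.numSets k / δ)) : 0 ≤ N.lambdaTest k c δ := by
  have hn := N.nr_pos
  have hw := N.maxWeight_pos
  unfold lambdaTest
  positivity

/-- The loop rarely ends with a lower bound that is not positive or above the optimum. -/
theorem expect_lowerBoundLoop_le (N : Network V r)
    {pick : List (Finset (Fin r × V)) → Finset V → V} (hpick : N.IsArgmaxRule pick) {k : ℕ}
    (hk : 1 ≤ k) (hkn : k ≤ Fintype.card V - N.rumor.card) {c δ : ℝ} (hc : 0 < c)
    (hδ : 0 < δ) (hδ1 : δ ≤ 1) (m i j : ℕ) :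
    ((N.multiSampling.insertSamples j []).expect fun L =>
      (N.lowerBoundLoop pick k c δ m i L).expect ({b | 0 < b ∧ b ≤ N.opt k}ᶜ.indicator 1)) ≤
        m * ENNReal.ofReal δ := by
  induction m generalizing i j with
  | zero =>
    simp only [lowerBoundLoop, PMF.expect_pure, PMF.expect_const]
    rw [Set.indicator_of_notMem]
    · simp
    · simpa using N.one_le_opt hk hkn
  | succ m ih =>
    have hx := N.guess_pos i
    have hlog : 0 ≤ Real.log (N.numSets k / δ) :=
      Real.log_nonneg ((one_le_div hδ).2 (hδ1.trans (N.one_le_numSets hkn)))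
    have hθ := div_nonneg (N.lambdaTest_nonneg hc.le hlog) hx.le
    set θ := N.lambdaTest k c δ / N.guess i with hθdef
    simp only [lowerBoundLoop, PMF.expect_bind, ← hθdef, N.fill_eq_insertSamples hθ]
    -- Old and new samples merge into `j' = max j (⌊θ⌋₊ + 1)` independent ones.
    rw [← PMF.expect_bind, PMF.insertSamples_bind, List.length_nil, zero_add]
    set j' := j + (⌊θ⌋₊ + 1 - j)
    have hj' : ⌊θ⌋₊ + 1 ≤ j' := by omega
    have hsplit : ((m + 1 : ℕ) : ℝ≥0∞) * ENNReal.ofReal δ =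
        ENNReal.ofReal δ + m * ENNReal.ofReal δ := by
      push_cast
      ring
    rw [hsplit]
    -- For each collection, failure is at most the overestimate indicator now plus the failure of
    -- the remaining loop. Adding the second term even where the loop stops avoids conditioning.
    refine le_trans (PMF.expect_mono _ fun L => ?_) ((PMF.expect_add _ _ _).trans_le
      (add_le_add (N.expect_overestimate_le hpick hkn hc hx hδ hδ1 (j := j') (by omega)
        ((Nat.lt_floor_add_one θ).le.trans (by exact_mod_cast hj'))) (ih (i + 1) j')))
    split_ifs with h
    · rw [PMF.expect_pure]
      refine le_trans ?_ le_self_add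
      refine Set.indicator_apply_le' (fun hb => ?_) fun _ => zero_le
      rw [Set.indicator_of_mem]
      · rfl
      refine ⟨h, lt_of_not_ge fun hle => hb ⟨div_pos (lt_of_lt_of_le ?_ h) ?_, hle⟩⟩ <;> positivity
    · exact le_add_self

theorem lambdaStar_nonneg (N : Network V r) {k : ℕ} (hkn : k ≤ Fintype.card V - N.rumor.card)
    {ε ℓ : ℝ} (hε : 0 < ε) (hℓ : 0 < ℓ) : 0 ≤ N.lambdaStar k ε ℓ := by
  have hn := N.nr_pos
  have hw := N.maxWeight_pos
  have he : 0 ≤ 2 - 1 / Real.exp 1 := by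
    have : 1 / Real.exp 1 ≤ 1 := (div_le_one (Real.exp_pos 1)).2 (Real.one_le_exp zero_le_one)
    linarith
  have hV : (1 : ℝ) ≤ (Fintype.card V : ℝ) ^ ℓ :=
    Real.one_le_rpow (Nat.one_le_cast.2 Fintype.card_pos) hℓ.le
  have hlog : 0 ≤ Real.log (N.numSets k * (2 * (Fintype.card V : ℝ) ^ ℓ)) :=
    Real.log_nonneg (one_le_mul_of_one_le_of_one_le (N.one_le_numSets hkn) (by linarith))
  unfold lambdaStar
  positivity

end
end Network
end MFRB

/-! ### Assembling the bound -/

theorem theorem4 {V : Type*} [Fintype V] [DecidableEq V] [Nonempty V] {r : ℕ} [NeZero r]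
    (N : MFRB.Network V r) (hnr : 2 ≤ Fintype.card V * r)
    (k : ℕ) (hk : 1 ≤ k) (hkn : k ≤ Fintype.card V - N.rumor.card)
    (ε ℓ δ₃ : ℝ) (hε : 0 < ε) (hℓ : 0 < ℓ)
    (hδ₃ : δ₃ = 1 / ((Fintype.card V : ℝ) ^ ℓ * Real.logb 2 ((Fintype.card V : ℝ) * r)))
    (pick : List (Finset (Fin r × V)) → Finset V → V) (hpick : N.IsArgmaxRule pick) :
    1 - 1 / (Fintype.card V : ℝ) ^ ℓ ≤
      ((N.sampling pick k ε ℓ δ₃).toOuterMeasure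
        {R | N.lambdaStar k ε ℓ / N.opt k ≤ (R.length : ℝ)}).toReal := by
  have hV : (1 : ℝ) ≤ (Fintype.card V : ℝ) ^ ℓ :=
    Real.one_le_rpow (Nat.one_le_cast.2 Fintype.card_pos) hℓ.le
  have hlogb : 1 ≤ Real.logb 2 ((Fintype.card V : ℝ) * r) := by
    rw [Real.le_logb_iff_rpow_le one_lt_two (by exact_mod_cast lt_of_lt_of_le two_pos hnr),
      Real.rpow_one]
    exact_mod_cast hnr
  have hδ : 0 < δ₃ := by rw [hδ₃]; positivity
  have hδ1 : δ₃ ≤ 1 := by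
    rw [hδ₃, div_le_one (by positivity)]
    exact one_le_mul_of_one_le_of_one_le hV hlogb
  have hstar := N.lambdaStar_nonneg hkn hε hℓ
  set good : Set (List (Finset (Fin r × V))) :=
    {R | N.lambdaStar k ε ℓ / N.opt k ≤ (R.length : ℝ)} with hgood
  set m := ⌊Real.logb 2 N.nr - 1⌋₊ with hm
  have hloop := N.expect_lowerBoundLoop_le hpick hk hkn (c := Real.sqrt 2 * ε)
    (by positivity) hδ hδ1 m 1 0
  simp only [PMF.insertSamples, PMF.expect_pure] at hloop
  have hbad : (N.sampling pick k ε ℓ δ₃).expect (goodᶜ.indicator 1) ≤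
      m * ENNReal.ofReal δ₃ := by
    rw [MFRB.Network.sampling, PMF.expect_bind]
    refine (PMF.expect_mono _ fun b => ?_).trans hloop
    by_cases hb : 0 < b ∧ b ≤ N.opt k
    · rw [N.fill_eq_insertSamples (div_nonneg hstar hb.1.le)]
      -- Given a good LB, the final length is deterministic and exceeds λ*/LB ≥ λ*/OPT, so this
      -- branch contributes zero.
      refine le_trans (PMF.expect_insertSamples_mono _ (g := fun _ => 0) _ _ fun L hL => ?_)
        (by rw [PMF.expect_const]; exact zero_le)
      rw [Set.indicator_of_notMem]
      rw [Set.notMem_compl_iff, hgood, Set.mem_ofPred_eq, hL]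
      refine (div_le_div_of_nonneg_left hstar hb.1 hb.2).trans ((Nat.lt_floor_add_one _).le.trans ?_)
      simp
    · rw [Set.indicator_of_mem (by exact hb)]
      refine le_trans (PMF.expect_mono _ (g := fun _ => 1) fun L => ?_)
        (PMF.expect_const _ _).le
      exact Set.indicator_le_self' (fun _ _ => zero_le) L
  -- The factor log₂(nr) in δ₃ pays for the union over the rounds.
  have hmδ : m * δ₃ ≤ 1 / (Fintype.card V : ℝ) ^ ℓ := by
    have hmle : (m : ℝ) ≤ Real.logb 2 ((Fintype.card V : ℝ) * r) :=
      (Nat.floor_le (sub_nonneg.2 hlogb)).trans (sub_le_self _ zero_le_one)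
    calc m * δ₃ ≤ Real.logb 2 ((Fintype.card V : ℝ) * r) * δ₃ := by gcongr
      _ = _ := by rw [hδ₃]; field_simp
  have hsum := (N.sampling pick k ε ℓ δ₃).expect_indicator_compl good
  rw [PMF.toOuterMeasure_eq_expect]
  have hfin : (N.sampling pick k ε ℓ δ₃).expect (good.indicator 1) ≠ ⊤ :=
    ne_top_of_le_ne_top ENNReal.one_ne_top (hsum ▸ le_self_add)
  have hone : (1 : ℝ≥0∞) ≤ (N.sampling pick k ε ℓ δ₃).expect (good.indicator 1) +
      ENNReal.ofReal (m * δ₃) := by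
    rw [← hsum, ENNReal.ofReal_mul (Nat.cast_nonneg m), ENNReal.ofReal_natCast]
    gcongr
  have h := ENNReal.toReal_mono (ENNReal.add_ne_top.2 ⟨hfin, ENNReal.ofReal_ne_top⟩) hone
  rw [ENNReal.toReal_one, ENNReal.toReal_add hfin ENNReal.ofReal_ne_top,
    ENNReal.toReal_ofReal (by positivity)] at h
  linarith
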